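/- **Definitions.** Let $n\ge 0$ and let $\langle i,j\rangle=\sum_k i_kj_k$ on $\mathbb{Z}_2^n$. A $\mathbb{Z}_2^n$-commutative algebra is a $\mathbb{Z}_2^n$-graded associative unital $\mathbb{R}$-algebra with $ab=(-1)^{\langle\deg a,\deg b\rangle}ba$ for homogeneous $a,b$. A locally $\mathbb{Z}_2^n$-ringed space is a Hausdorff second-countable space $M$ with a sheaf $\mathcal{A}_M$ of $\mathbb{Z}_2^n$-commutative algebras (restrictions preserving degrees), each of whose stalks has a unique maximal homogeneous ideal. For $p\in\mathbb{N}$ and $\mathbf{q}=(q_\gamma)_{\gamma\in\mathbb{Z}_2^n\setminus\{0\}}$, $q_\gamma\in\mathbb{N}$, a $\mathbb{Z}_2^n$-supermanifold of dimension $p|\mathbf{q}$ is a locally $\mathbb{Z}_2^n$-ringed space $(M,\mathcal{A}_M)$ that is locally isomorphic, as such, to $(V,\ C^\infty_{V}[[\xi^1,\dots,\xi^q]])$ with $V\subset\mathbb{R}^p$ open, where the $\xi^a$ are formal variables, $q_\gamma$ of them of degree $\gamma$ for each $\gamma\neq0$, with $\xi^a\xi^b=(-1)^{\langle\deg\xi^a,\deg\xi^b\rangle}\xi^b\xi^a$.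 **Proposition 6.1.** Let $(M,\mathcal{A}_M)$ be a $\mathbb{Z}_2^n$-supermanifold of dimension $p|\mathbf{q}$. 1. For every open $U\subset M$, $f\in\mathcal{A}_M(U)$ and $m\in U$ there is a unique $k\in\mathbb{R}$ such that $f-k$ is not invertible in any open neighborhood of $m$ in $U$. Denote it by $\varepsilon_U(f)(m)$. 2. $M$ carries a smooth manifold structure of dimension $p$ for which each $\varepsilon_U(f)$ is a smooth function on $U$, the maps $\varepsilon_U$ form a morphism $\varepsilon:\mathcal{A}_M\to C^\infty_M$ of sheaves of unital $\mathbb{R}$-algebras, and, with $\mathcal{J}_M=\ker\varepsilon$, the sequence of sheaves $$0\to\mathcal{J}_M\to\mathcal{A}_M\xrightarrow{\ \varepsilon\ }C^\infty_M\to0$$ is short exact. 3. This structure is canonical: any two smooth manifold structures of dimension $p$ on $M$ with the properties in 2 have the same maximal smooth atlas. -/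

import Mathlib

open CategoryTheory TopologicalSpace Opposite
open scoped Manifold ContDiff

universe u

/-! ### The grading group and the sign rule -/

/-- The grading group `ℤ₂ⁿ`. -/
abbrev Z2n (n : ℕ) : Type := Fin n → ZMod 2

/-- The commutation factor `(-1)^⟨i, j⟩` of the standard scalar product
`⟨i, j⟩ = i₁ j₁ + ⋯ + iₙ jₙ` on `ℤ₂ⁿ`. -/
def z2nSign {n : ℕ} (i j : Z2n n) : ℤ := (-1) ^ (∑ k, (i k).val * (j k).val)

/-! ### Formal power series in `ℤ₂ⁿ`-commuting variables -/

/-- Exponents of the monomials `(ξ¹)^μ₁ ⋯ (ξ^q)^μ_q` in variables `ξᵃ` of degrees `σ a`: an odd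
variable, i.e. one with `⟨σ a, σ a⟩` odd, squares to zero, so its exponent is at most one. -/
def IsExponent {n q : ℕ} (σ : Fin q → Z2n n) (μ : Fin q →₀ ℕ) : Prop :=
  ∀ a, z2nSign (σ a) (σ a) = -1 → μ a ≤ 1

/-- The sign in `ξ^μ ξ^ν = ± ξ^(μ+ν)`, obtained by moving each `ξᵇ` in `ξ^ν` to the left across
the variables `ξᵃ` in `ξ^μ` with `b < a`. -/
def reorderSign {n q : ℕ} (σ : Fin q → Z2n n) (μ ν : Fin q →₀ ℕ) : ℤ :=
  ∏ a, ∏ b, if b < a then z2nSign (σ a) (σ b) ^ (μ a * ν b) else 1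

/-- The algebra `R[[ξ¹, …, ξ^q]]_σ` of formal power series `∑ f_μ ξ^μ` with coefficients in `R`,
in variables of degrees `σ 1, …, σ q` subject to `ξᵃ ξᵇ = (-1)^⟨σ a, σ b⟩ ξᵇ ξᵃ`. -/
def SuperSeries {n q : ℕ} (σ : Fin q → Z2n n) (R : Type*) : Type _ :=
  {μ : Fin q →₀ ℕ // IsExponent σ μ} → R

namespace SuperSeries

variable {n q : ℕ} {σ : Fin q → Z2n n} {R : Type*}

/-- The coefficient of `ξ^μ`, for an arbitrary multi-index (zero if `ξ^μ = 0`). -/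
noncomputable def coeff [Zero R] (μ : Fin q →₀ ℕ) (f : SuperSeries σ R) : R :=
  open Classical in if h : IsExponent σ μ then f ⟨μ, h⟩ else 0

noncomputable instance [AddCommGroup R] : AddCommGroup (SuperSeries σ R) :=
  inferInstanceAs (AddCommGroup ({μ : Fin q →₀ ℕ // IsExponent σ μ} → R))

noncomputable instance {k : Type*} [Semiring k] [AddCommGroup R] [Module k R] :
    Module k (SuperSeries σ R) :=
  inferInstanceAs (Module k ({μ : Fin q →₀ ℕ // IsExponent σ μ} → R))

theorem coeff_of_isExponent [Zero R] {μ : Fin q →₀ ℕ} (h : IsExponent σ μ) (f : SuperSeries σ R) :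
    coeff μ f = f ⟨μ, h⟩ := dif_pos h

theorem coeff_of_not_isExponent [Zero R] {μ : Fin q →₀ ℕ} (h : ¬ IsExponent σ μ)
    (f : SuperSeries σ R) : coeff μ f = 0 := dif_neg h

theorem ext_coeff [Zero R] {f g : SuperSeries σ R}
    (h : ∀ μ, IsExponent σ μ → coeff μ f = coeff μ g) : f = g := by
  funext μ
  have := h μ.1 μ.2
  rwa [coeff_of_isExponent μ.2, coeff_of_isExponent μ.2] at this

section Add
variable [AddCommGroup R]

@[simp] theorem coeff_add (μ : Fin q →₀ ℕ) (f g : SuperSeries σ R) :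
    coeff μ (f + g) = coeff μ f + coeff μ g := by
  by_cases h : IsExponent σ μ
  · simp only [coeff_of_isExponent h]; rfl
  · simp only [coeff_of_not_isExponent h, add_zero]

@[simp] theorem coeff_zero (μ : Fin q →₀ ℕ) : coeff μ (0 : SuperSeries σ R) = 0 := by
  by_cases h : IsExponent σ μ
  · simp only [coeff_of_isExponent h]; rfl
  · simp only [coeff_of_not_isExponent h]

@[simp] theorem coeff_smul {k : Type*} [Semiring k] [Module k R] (c : k) (μ : Fin q →₀ ℕ)
    (f : SuperSeries σ R) : coeff μ (c • f) = c • coeff μ f := by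
  by_cases h : IsExponent σ μ
  · simp only [coeff_of_isExponent h]; rfl
  · simp only [coeff_of_not_isExponent h, smul_zero]

end Add

theorem isExponent_of_le {μ ν : Fin q →₀ ℕ} (h : IsExponent σ ν) (hle : μ ≤ ν) :
    IsExponent σ μ := fun a ha => (hle a).trans (h a ha)

theorem reorderSign_add_left (μ μ' ν : Fin q →₀ ℕ) :
    reorderSign σ (μ + μ') ν = reorderSign σ μ ν * reorderSign σ μ' ν := by
  simp only [reorderSign, ← Finset.prod_mul_distrib]
  refine Finset.prod_congr rfl fun a _ => Finset.prod_congr rfl fun b _ => ?_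
  split_ifs
  · simp [add_mul, pow_add]
  · simp

theorem reorderSign_add_right (μ ν ν' : Fin q →₀ ℕ) :
    reorderSign σ μ (ν + ν') = reorderSign σ μ ν * reorderSign σ μ ν' := by
  simp only [reorderSign, ← Finset.prod_mul_distrib]
  refine Finset.prod_congr rfl fun a _ => Finset.prod_congr rfl fun b _ => ?_
  split_ifs
  · simp [mul_add, pow_add]
  · simp

@[simp] theorem reorderSign_zero_left (ν : Fin q →₀ ℕ) : reorderSign σ 0 ν = 1 := by
  simp [reorderSign]

@[simp] theorem reorderSign_zero_right (μ : Fin q →₀ ℕ) : reorderSign σ μ 0 = 1 := by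
  simp [reorderSign]

theorem isExponent_zero : IsExponent σ 0 := fun _ _ => by simp

variable [CommRing R]

noncomputable instance : One (SuperSeries σ R) :=
  ⟨fun μ => @ite R (μ.1 = 0) (Classical.propDecidable _) 1 0⟩

/-- `(f g)_ρ = ∑_{μ + ν = ρ} ± f_μ g_ν`. -/
noncomputable instance : Mul (SuperSeries σ R) :=
  ⟨fun f g ρ => ∑ x ∈ Finset.HasAntidiagonal.antidiagonal ρ.1,
    (reorderSign σ x.1 x.2 : R) * (coeff x.1 f * coeff x.2 g)⟩

theorem coeff_mul {ρ : Fin q →₀ ℕ} (h : IsExponent σ ρ) (f g : SuperSeries σ R) :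
    coeff ρ (f * g) = ∑ x ∈ Finset.HasAntidiagonal.antidiagonal ρ,
      (reorderSign σ x.1 x.2 : R) * (coeff x.1 f * coeff x.2 g) :=
  coeff_of_isExponent h _

theorem coeff_one [DecidableEq (Fin q →₀ ℕ)] (μ : Fin q →₀ ℕ) :
    coeff μ (1 : SuperSeries σ R) = if μ = 0 then 1 else 0 := by
  by_cases h : IsExponent σ μ
  · rw [coeff_of_isExponent h]
    change (@ite R (μ = 0) (Classical.propDecidable _) 1 0) = _
    congr
  · rw [coeff_of_not_isExponent h, if_neg]
    rintro rfl
    exact h isExponent_zero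

protected theorem mul_assoc (f g h : SuperSeries σ R) : f * g * h = f * (g * h) := by
  classical
  refine ext_coeff fun ρ hρ => ?_
  rw [coeff_mul hρ, coeff_mul hρ]
  have h1 : ∀ x ∈ Finset.HasAntidiagonal.antidiagonal ρ,
      (reorderSign σ x.1 x.2 : R) * (coeff x.1 (f * g) * coeff x.2 h) =
      ∑ y ∈ Finset.HasAntidiagonal.antidiagonal x.1, (reorderSign σ x.1 x.2 : R) *
        ((reorderSign σ y.1 y.2 : R) * (coeff y.1 f * coeff y.2 g) * coeff x.2 h) := by
    intro x hx
    rw [coeff_mul (isExponent_of_le hρ (show x.1 ≤ ρ from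
        Finset.HasAntidiagonal.mem_antidiagonal.1 hx ▸ le_self_add)), Finset.sum_mul,
      Finset.mul_sum]
  have h2 : ∀ x ∈ Finset.HasAntidiagonal.antidiagonal ρ,
      (reorderSign σ x.1 x.2 : R) * (coeff x.1 f * coeff x.2 (g * h)) =
      ∑ y ∈ Finset.HasAntidiagonal.antidiagonal x.2, (reorderSign σ x.1 x.2 : R) *
        (coeff x.1 f * ((reorderSign σ y.1 y.2 : R) * (coeff y.1 g * coeff y.2 h))) := by
    intro x hx
    rw [coeff_mul (isExponent_of_le hρ (show x.2 ≤ ρ from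
        Finset.HasAntidiagonal.mem_antidiagonal.1 hx ▸ le_add_self)), Finset.mul_sum,
      Finset.mul_sum]
  rw [Finset.sum_congr rfl h1, Finset.sum_congr rfl h2]
  simp only [Finset.sum_sigma']
  refine Finset.sum_nbij' (fun ⟨⟨_i, j⟩, ⟨k, l⟩⟩ ↦ ⟨(k, l + j), (l, j)⟩)
    (fun ⟨⟨i, _j⟩, ⟨k, l⟩⟩ ↦ ⟨(i + k, l), (i, k)⟩) ?_ ?_ ?_ ?_ ?_
  · rintro ⟨⟨i, j⟩, ⟨k, l⟩⟩ hx
    simp only [Finset.mem_sigma, Finset.HasAntidiagonal.mem_antidiagonal] at hx ⊢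
    exact ⟨by rw [← hx.1, ← hx.2, add_assoc], trivial⟩
  · rintro ⟨⟨i, j⟩, ⟨k, l⟩⟩ hx
    simp only [Finset.mem_sigma, Finset.HasAntidiagonal.mem_antidiagonal] at hx ⊢
    exact ⟨by rw [← hx.1, ← hx.2, add_assoc], trivial⟩
  · rintro ⟨⟨i, j⟩, ⟨k, l⟩⟩ hx
    simp only [Finset.mem_sigma, Finset.HasAntidiagonal.mem_antidiagonal] at hx
    obtain ⟨-, rfl⟩ := hx
    rfl
  · rintro ⟨⟨i, j⟩, ⟨k, l⟩⟩ hx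
    simp only [Finset.mem_sigma, Finset.HasAntidiagonal.mem_antidiagonal] at hx
    obtain ⟨-, rfl⟩ := hx
    rfl
  · rintro ⟨⟨i, j⟩, ⟨k, l⟩⟩ hx
    simp only [Finset.mem_sigma, Finset.HasAntidiagonal.mem_antidiagonal] at hx
    obtain ⟨-, rfl⟩ := hx
    simp only [reorderSign_add_left, reorderSign_add_right]
    push_cast
    ring

noncomputable instance : Ring (SuperSeries σ R) :=
  { (inferInstance : AddCommGroup (SuperSeries σ R)),
    (inferInstance : Mul (SuperSeries σ R)),
    (inferInstance : One (SuperSeries σ R)) with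
    mul_assoc := SuperSeries.mul_assoc
    one_mul := fun f => by
      classical
      refine ext_coeff fun ρ hρ => ?_
      rw [coeff_mul hρ, Finset.sum_eq_single (0, ρ)]
      · simp [coeff_one]
      · rintro ⟨i, j⟩ hx hne
        have : i ≠ 0 := by
          rintro rfl
          simp only [Finset.HasAntidiagonal.mem_antidiagonal, zero_add] at hx
          exact hne (by rw [hx])
        simp [coeff_one, this]
      · intro hx
        simp at hx
    mul_one := fun f => by
      classical
      refine ext_coeff fun ρ hρ => ?_
      rw [coeff_mul hρ, Finset.sum_eq_single (ρ, 0)]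
      · simp [coeff_one]
      · rintro ⟨i, j⟩ hx hne
        have : j ≠ 0 := by
          rintro rfl
          simp only [Finset.HasAntidiagonal.mem_antidiagonal, add_zero] at hx
          exact hne (by rw [hx])
        simp [coeff_one, this]
      · intro hx
        simp at hx
    left_distrib := fun f g h => by
      refine ext_coeff fun ρ hρ => ?_
      simp only [coeff_mul hρ, coeff_add, ← Finset.sum_add_distrib, mul_add]
    right_distrib := fun f g h => by
      refine ext_coeff fun ρ hρ => ?_
      simp only [coeff_mul hρ, coeff_add, ← Finset.sum_add_distrib, mul_add, add_mul]
    zero_mul := fun f => by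
      refine ext_coeff fun ρ hρ => ?_
      simp [coeff_mul hρ]
    mul_zero := fun f => by
      refine ext_coeff fun ρ hρ => ?_
      simp [coeff_mul hρ] }

noncomputable instance {k : Type*} [CommRing k] [Algebra k R] : Algebra k (SuperSeries σ R) :=
  Algebra.ofModule
    (fun c f g => by
      refine ext_coeff fun ρ hρ => ?_
      simp only [coeff_mul hρ, coeff_smul, Finset.smul_sum, smul_mul_assoc, mul_smul_comm])
    (fun c f g => by
      refine ext_coeff fun ρ hρ => ?_
      simp only [coeff_mul hρ, coeff_smul, Finset.smul_sum, mul_smul_comm])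

/-- The degree `∑ μ_a σ_a` of the monomial `ξ^μ`. -/
def monomialDeg (σ : Fin q → Z2n n) (μ : Fin q →₀ ℕ) : Z2n n := ∑ a, μ a • σ a

/-- The homogeneous series of degree `γ`: only monomials of degree `γ` occur. -/
def homogeneous (σ : Fin q → Z2n n) (R : Type*) [CommRing R] [Algebra ℝ R] (γ : Z2n n) :
    Submodule ℝ (SuperSeries σ R) where
  carrier := {f | ∀ μ, coeff μ f ≠ 0 → monomialDeg σ μ = γ}
  add_mem' {f g} hf hg μ h := by
    by_cases h0 : coeff μ f = 0
    · exact hg μ (by simpa [h0] using h)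
    · exact hf μ h0
  zero_mem' μ h := absurd (coeff_zero μ) h
  smul_mem' c f hf μ h := hf μ fun h0 => h (by simp [h0])

/-- Coefficientwise application of an algebra morphism. -/
noncomputable def map {S : Type*} [CommRing S] [Algebra ℝ R] [Algebra ℝ S] (φ : R →ₐ[ℝ] S) :
    SuperSeries σ R →ₐ[ℝ] SuperSeries σ S :=
  have hc : ∀ (μ : Fin q →₀ ℕ) (f : SuperSeries σ R),
      coeff μ (fun ν => φ (f ν) : SuperSeries σ S) = φ (coeff μ f) := fun μ f => by
    by_cases h : IsExponent σ μ
    · exact (coeff_of_isExponent h _).trans (by rw [coeff_of_isExponent h f])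
    · exact (coeff_of_not_isExponent h _).trans (by rw [coeff_of_not_isExponent h f, map_zero])
  AlgHom.ofLinearMap
    { toFun := fun f ν => φ (f ν)
      map_add' := fun f g => funext fun ν => map_add φ (f ν) (g ν)
      map_smul' := fun c f => funext fun ν => map_smul φ c (f ν) }
    (by
      classical
      refine ext_coeff fun ρ _ => ?_
      refine (hc ρ 1).trans ?_
      rw [coeff_one, coeff_one]
      split_ifs <;> simp)
    (fun f g => by
      refine ext_coeff fun ρ hρ => ?_
      refine (hc ρ (f * g)).trans ?_
      rw [coeff_mul hρ, coeff_mul hρ, map_sum]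
      refine Finset.sum_congr rfl fun x _ => ?_
      have h1 := hc x.1 f
      have h2 := hc x.2 g
      rw [map_mul, map_mul, map_intCast, ← h1, ← h2]
      rfl)

end SuperSeries

/-! ### Smooth functions -/

section Smooth

variable (p : ℕ) {M : Type u} [TopologicalSpace M]
  [ChartedSpace (EuclideanSpace ℝ (Fin p)) M]

/-- The algebra `C^∞(U)` of real smooth functions on an open subset of a `p`-manifold. -/
abbrev SmoothFun (U : Opens M) : Type u := C^∞⟮𝓡 p, U; 𝓘(ℝ, ℝ), ℝ⟯

/-- Restriction of smooth functions. -/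
noncomputable def SmoothFun.res {U V : Opens M} (h : U ≤ V) : SmoothFun p V →ₐ[ℝ] SmoothFun p U :=
  { ContMDiffMap.restrictRingHom (𝓡 p) 𝓘(ℝ, ℝ) ℝ h with commutes' := fun _ => rfl }

variable (M)

/-- The presheaf `C^∞_M` of `ℝ`-algebras. -/
noncomputable def smoothAlgPresheaf : TopCat.Presheaf (AlgCat.{u} ℝ) (TopCat.of M) where
  obj U := AlgCat.of ℝ (SmoothFun p (M := M) (unop U))
  map i := AlgCat.ofHom (SmoothFun.res p (leOfHom i.unop))
  map_id _ := rfl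
  map_comp _ _ := rfl

theorem smoothAlgPresheaf_isSheaf : (smoothAlgPresheaf p M).IsSheaf := by
  rw [TopCat.Presheaf.isSheaf_iff_isSheafUniqueGluing]
  intro ι U sf hsf
  let g (i : ι) : SmoothFun p (M := M) (U i) := sf i
  have hagree : ∀ (i j : ι) (x : M) (hi : x ∈ U i) (hj : x ∈ U j), g i ⟨x, hi⟩ = g j ⟨x, hj⟩ :=
    fun i j x hi hj => congrArg
      (fun s : SmoothFun p (M := M) (U i ⊓ U j) => s ⟨x, hi, hj⟩) (hsf i j)
  have hex : ∀ x : ↥(iSup U), ∃ i, (x : M) ∈ U i := fun x => Opens.mem_iSup.1 x.2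
  choose c hc using hex
  let F : ↥(iSup U) → ℝ := fun x => g (c x) ⟨x, hc x⟩
  have hF : ∀ (i : ι) (x : M) (hi : x ∈ U i) (hx : x ∈ iSup U), F ⟨x, hx⟩ = g i ⟨x, hi⟩ :=
    fun i x hi hx => hagree _ _ _ _ _
  have hsmooth : ContMDiff (𝓡 p) 𝓘(ℝ, ℝ) ∞ F := by
    intro x
    let G : M → ℝ := fun y => open Classical in if h : y ∈ iSup U then F ⟨y, h⟩ else 0
    have h1 : F = fun y : ↥(iSup U) => G y := funext fun y => by
      simp only [G, SetLike.coe_mem, dite_true, Subtype.coe_eta]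
    have h2 : ⇑(g (c x)) = fun y : ↥(U (c x)) => G y := funext fun y =>
      ((dif_pos (le_iSup U (c x) y.2)).trans (hF _ _ y.2 _)).symm
    have h3 : ContMDiffAt (𝓡 p) 𝓘(ℝ, ℝ) ∞ G x := by
      refine (contMDiffAt_subtype_iff (U := (U (c x) : Opens M)) (x := ⟨x, hc x⟩)).1 ?_
      rw [← h2]
      exact (g (c x)).contMDiff _
    rw [h1]
    exact (contMDiffAt_subtype_iff (U := (iSup U : Opens M)) (x := x)).2 h3
  refine ⟨(⟨F, hsmooth⟩ : SmoothFun p (M := M) (iSup U)), fun i => ?_, fun s hs => ?_⟩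
  · exact ContMDiffMap.ext fun x => hF i x x.2 _
  · refine ContMDiffMap.ext (f := (s : SmoothFun p (M := M) (iSup U))) fun x => ?_
    exact congrArg (fun t : SmoothFun p (M := M) (U (c x)) => t ⟨x, hc x⟩) (hs (c x))

/-- The sheaf `C^∞_M` of smooth functions, as a sheaf of `ℝ`-algebras. -/
noncomputable def smoothAlgSheaf : TopCat.Sheaf (AlgCat.{u} ℝ) (TopCat.of M) :=
  ⟨smoothAlgPresheaf p M, smoothAlgPresheaf_isSheaf p M⟩

end Smooth

/-- A smooth structure of dimension `p` on a topological space. -/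
structure SmoothStructure (p : ℕ) (M : Type u) [TopologicalSpace M] where
  /-- The charts. -/
  charted : ChartedSpace (EuclideanSpace ℝ (Fin p)) M
  /-- The changes of charts are smooth. -/
  isManifold : IsManifold (𝓡 p) ∞ M

namespace SmoothStructure

variable {p : ℕ} {M : Type u} [TopologicalSpace M]

/-- The maximal smooth atlas; two smooth structures are the same iff these agree. -/
def maximalAtlas (S : SmoothStructure p M) :
    Set (OpenPartialHomeomorph M (EuclideanSpace ℝ (Fin p))) :=
  letI := S.charted
  IsManifold.maximalAtlas (𝓡 p) ∞ M

/-- The sheaf `C^∞_M` for the given smooth structure. -/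
noncomputable def sheaf (S : SmoothStructure p M) : TopCat.Sheaf (AlgCat.{u} ℝ) (TopCat.of M) :=
  letI := S.charted
  smoothAlgSheaf p M

/-- The value at `m ∈ U` of a section of `C^∞_M` over `U`. -/
noncomputable def eval (S : SmoothStructure p M) {U : Opens M} (g : S.sheaf.presheaf.obj (op U)) (m : U) : ℝ :=
  letI := S.charted
  (show SmoothFun p U from g) m

end SmoothStructure

/-! ### Locally `ℤ₂ⁿ`-ringed spaces and `ℤ₂ⁿ`-supermanifolds -/

/-- The structure sheaf of a `ℤ₂ⁿ`-ringed space on `M`: a sheaf of `ℤ₂ⁿ`-graded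
`ℤ₂ⁿ`-commutative associative unital `ℝ`-algebras. -/
structure Z2nRingedSpace (n : ℕ) (M : Type u) [TopologicalSpace M] where
  /-- The underlying sheaf of associative unital `ℝ`-algebras. -/
  sheaf : TopCat.Sheaf (AlgCat.{u} ℝ) (TopCat.of M)
  /-- The homogeneous components. -/
  deg (U : Opens M) (γ : Z2n n) : Submodule ℝ (sheaf.presheaf.obj (op U))
  /-- Each algebra of sections is the direct sum of its homogeneous components. -/
  isInternal (U : Opens M) : DirectSum.IsInternal (deg U)
  one_mem (U : Opens M) : (1 : sheaf.presheaf.obj (op U)) ∈ deg U 0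
  mul_mem (U : Opens M) {γ δ : Z2n n} {a b : sheaf.presheaf.obj (op U)} :
    a ∈ deg U γ → b ∈ deg U δ → a * b ∈ deg U (γ + δ)
  /-- The sign rule `a b = (-1)^⟨γ, δ⟩ b a`. -/
  mul_comm_sign (U : Opens M) {γ δ : Z2n n} {a b : sheaf.presheaf.obj (op U)} :
    a ∈ deg U γ → b ∈ deg U δ → a * b = z2nSign γ δ • (b * a)
  /-- Restrictions respect the degree. -/
  map_mem {U V : Opens M} (i : U ⟶ V) {γ : Z2n n} {a : sheaf.presheaf.obj (op V)} :
    a ∈ deg V γ → (sheaf.presheaf.map i.op).hom a ∈ deg U γ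

namespace Z2nRingedSpace

variable {n : ℕ} {M : Type u} [TopologicalSpace M] (A : Z2nRingedSpace n M)

/-- The algebra `A(U)` of sections over `U`. -/
abbrev Sec (U : Opens M) : Type u := A.sheaf.presheaf.obj (op U)

/-- The restriction morphism `A(V) → A(U)`. -/
noncomputable abbrev res {U V : Opens M} (h : U ≤ V) : A.Sec V →ₐ[ℝ] A.Sec U :=
  (A.sheaf.presheaf.map (homOfLE h).op).hom

/-- The structure sheaf viewed as a presheaf of rings. -/
noncomputable abbrev ringPresheaf : TopCat.Presheaf RingCat.{u} (TopCat.of M) :=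
  A.sheaf.presheaf ⋙ forget₂ (AlgCat.{u} ℝ) RingCat.{u}

/-- The stalk at `m`. -/
noncomputable abbrev Stalk (m : M) : Type u :=
  A.ringPresheaf.stalk (show TopCat.of M from m)

/-- The germ at `m` of a section over `U`. -/
noncomputable def germ {U : Opens M} (m : M) (hm : m ∈ U) (f : A.Sec U) : A.Stalk m :=
  (A.ringPresheaf.germ U (show TopCat.of M from m) hm).hom f

/-- The homogeneous elements of a stalk are the germs of homogeneous sections. -/
def IsHomogeneousElem (m : M) (s : A.Stalk m) : Prop :=
  ∃ (U : Opens M) (hm : m ∈ U) (γ : Z2n n) (f : A.Sec U), f ∈ A.deg U γ ∧ A.germ m hm f = s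

/-- Homogeneous ideals of a stalk: those generated by homogeneous elements. By the sign rule such
a left ideal is two-sided. -/
def IsHomogeneousIdeal (m : M) (I : Ideal (A.Stalk m)) : Prop :=
  Ideal.span {s | s ∈ I ∧ A.IsHomogeneousElem m s} = I

/-- A `ℤ₂ⁿ`-ringed space is local if each stalk has a unique maximal homogeneous ideal. -/
def IsLocal : Prop :=
  ∀ m : M, ∃! I : Ideal (A.Stalk m), Maximal (fun J => A.IsHomogeneousIdeal m J ∧ J ≠ ⊤) I

/-- The algebra `O(W) = C^∞(W)[[ξ¹, …, ξ^q]]_σ` of functions of the `ℤ₂ⁿ`-superdomain. -/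
abbrev DomainFun {p q : ℕ} (σ : Fin q → Z2n n) (W : Opens (EuclideanSpace ℝ (Fin p))) : Type :=
  SuperSeries σ (SmoothFun p W)

/-- An isomorphism of `ℤ₂ⁿ`-ringed spaces from the restriction of `(M, A)` to an open subset
(the source of `base`) onto the `ℤ₂ⁿ`-superdomain over an open subset of `ℝᵖ` (the target of
`base`), with formal variables of degrees `σ`. It automatically respects the unique maximal
homogeneous ideals of the stalks. -/
structure SuperChart (A : Z2nRingedSpace n M) (p : ℕ) {q : ℕ} (σ : Fin q → Z2n n) where
  /-- The base homeomorphism `φ`. -/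
  base : OpenPartialHomeomorph M (EuclideanSpace ℝ (Fin p))
  /-- The pullbacks `φ^*_W : O(W) ≃ A(φ⁻¹(W))`, for `W` open in the target. -/
  pullback (W : Opens (EuclideanSpace ℝ (Fin p))) (hW : (W : Set _) ⊆ base.target) :
    DomainFun σ W ≃ₐ[ℝ] A.Sec ⟨base.source ∩ base ⁻¹' W, base.isOpen_inter_preimage W.isOpen⟩
  /-- The pullbacks respect the degree. -/
  pullback_mem (W : Opens (EuclideanSpace ℝ (Fin p))) (hW : (W : Set _) ⊆ base.target)
    (γ : Z2n n) (f : DomainFun σ W) :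
    f ∈ SuperSeries.homogeneous σ (SmoothFun p W) γ ↔ pullback W hW f ∈ A.deg _ γ
  /-- The pullbacks commute with restrictions. -/
  pullback_res {W W' : Opens (EuclideanSpace ℝ (Fin p))} (h : W' ≤ W)
    (hW : (W : Set _) ⊆ base.target) (f : DomainFun σ W) :
    pullback W' (fun _ hx => hW (h hx)) (SuperSeries.map (SmoothFun.res p h) f) =
      A.res (Set.inter_subset_inter_right _ (Set.preimage_mono h)) (pullback W hW f)

/-- `(M, A)` is a `ℤ₂ⁿ`-supermanifold of dimension `p|d`, where `d` prescribes the number of formal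
variables of each nonzero degree: `M` is Hausdorff and second countable, the stalks are local, and
`(M, A)` is locally isomorphic to a `ℤ₂ⁿ`-superdomain of dimension `p|d`. -/
structure IsSupermanifold (A : Z2nRingedSpace n M) (p : ℕ) (d : {γ : Z2n n // γ ≠ 0} → ℕ) :
    Prop where
  t2 : T2Space M
  secondCountable : SecondCountableTopology M
  isLocal : A.IsLocal
  exists_chart : ∀ m : M, ∃ (q : ℕ) (σ : Fin q → Z2n n),
    (∀ a, σ a ≠ 0) ∧ (∀ γ : {γ : Z2n n // γ ≠ 0}, Nat.card {a // σ a = γ} = d γ) ∧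
    ∃ φ : A.SuperChart p σ, m ∈ φ.base.source

/-- `f - k` is not invertible in any neighbourhood of `m` in `U`. -/
def NotInvertibleNear {U : Opens M} (f : A.Sec U) (m : U) (k : ℝ) : Prop :=
  ∀ (V : Opens M) (hV : V ≤ U), (m : M) ∈ V →
    ¬ IsUnit (A.res hV (f - algebraMap ℝ (A.Sec U) k))

end Z2nRingedSpace

/-- The forgetful functor from sheaves of `ℝ`-algebras to the abelian category of sheaves of abelian
groups. -/
noncomputable abbrev toAbSheaf (M : Type u) [TopologicalSpace M] :
    TopCat.Sheaf (AlgCat.{u} ℝ) (TopCat.of M) ⥤ TopCat.Sheaf AddCommGrpCat.{u} (TopCat.of M) :=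
  sheafCompose (Opens.grothendieckTopology (TopCat.of M))
    (forget₂ (AlgCat.{u} ℝ) (ModuleCat.{u} ℝ) ⋙ forget₂ (ModuleCat.{u} ℝ) AddCommGrpCat.{u})

/-- The sequence of sheaves `0 → J → A → B → 0` attached to a morphism `ε : A → B` of sheaves of
algebras, where `J` is the kernel of `ε`. -/
noncomputable def kernelSequence {M : Type u} [TopologicalSpace M]
    {A B : TopCat.Sheaf (AlgCat.{u} ℝ) (TopCat.of M)} (ε : A ⟶ B) :
    ShortComplex (TopCat.Sheaf AddCommGrpCat.{u} (TopCat.of M)) :=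
  ShortComplex.mk (Limits.kernel.ι ((toAbSheaf M).map ε)) ((toAbSheaf M).map ε)
    (Limits.kernel.condition _)

/-!
The structure sheaf of a `ℤ₂ⁿ`-supermanifold determines a smooth structure on the base through the
invertibility of its sections.

A formal power series is invertible if and only if its body, the coefficient of `ξ⁰`, is
(`SuperSeries.isUnit_iff_body`): the coefficients of an inverse can be computed recursively. In a
chart `φ` around `m`, therefore, a section `f` minus a number `k` is invertible near `m` exactly
when the body of `f` differs from `k` at `φ m`
(`Z2nRingedSpace.SuperChart.notInvertibleNear_iff`). This gives existence and uniqueness of the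
value `ε(f)(m)`, and shows that `ε(f)`, read in any chart, is the body of `f`; in particular
`ε` is an algebra morphism and `ε(f)` is smooth in every chart.

The coordinates of a chart `ψ` are themselves bodies of sections, so they are smooth in every other
chart (`Z2nRingedSpace.SuperChart.contDiffOn_transition`), and the charts form a smooth atlas. A
smooth function is, in a chart, the body of the power series with this function as its only term;
hence `ε` is locally surjective, which is what exactness of the sequence amounts to
(`Z2nRingedSpace.IsSupermanifold.shortExact_toSmooth`).

Conversely, for any smooth structure with such an exact sequence, the smooth functions are
those which are locally values of sections, and the values are determined by invertibility. So any
two such structures have the same smooth functions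
(`Z2nRingedSpace.IsSupermanifold.smoothOn_iff`) and therefore, because the coordinates of charts
are smooth functions, the same maximal atlas (`SmoothStructure.maximalAtlas_eq`).
-/

/-! ### Units among formal power series -/

namespace SuperSeries

variable {n q : ℕ} {σ : Fin q → Z2n n} {R : Type*} [CommRing R]

theorem coeff_zero_mul (f g : SuperSeries σ R) :
    coeff 0 (f * g) = coeff 0 f * coeff 0 g := by
  simp [coeff_mul isExponent_zero]

theorem coeff_zero_one : coeff 0 (1 : SuperSeries σ R) = 1 := by
  classical
  simp [coeff_one]

/-- The body `f ↦ f₀` of a formal power series: its coefficient at `ξ⁰`. -/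
noncomputable def body [Algebra ℝ R] : SuperSeries σ R →ₐ[ℝ] R :=
  AlgHom.ofLinearMap
    { toFun := coeff 0
      map_add' := coeff_add 0
      map_smul' := fun c f => coeff_smul c 0 f }
    coeff_zero_one coeff_zero_mul

/-- The series `r ξ⁰`. -/
noncomputable def const (σ : Fin q → Z2n n) (r : R) : SuperSeries σ R :=
  fun μ => open Classical in if μ.1 = 0 then r else 0

/-- The coefficients of the right inverse of a series `f` whose body has inverse `u`, determined
recursively by comparing coefficients in `f g = 1`. -/
noncomputable def invCoeff (f : SuperSeries σ R) (u : R) (ρ : Fin q →₀ ℕ) : R :=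
  open Classical in
  if ρ = 0 then u
  else -u * ∑ x ∈ Finset.HasAntidiagonal.antidiagonal ρ, if _ : x.2 < ρ then
    (reorderSign σ x.1 x.2 : R) * (coeff x.1 f * invCoeff f u x.2) else 0
termination_by ρ

theorem exists_right_inv (f : SuperSeries σ R) {u : R} (hu : coeff 0 f * u = 1) :
    ∃ g : SuperSeries σ R, f * g = 1 ∧ coeff 0 g = u := by
  classical
  let g : SuperSeries σ R := fun ρ => invCoeff f u ρ.1
  have hg : ∀ ρ, IsExponent σ ρ → coeff ρ g = invCoeff f u ρ := fun ρ h => coeff_of_isExponent h g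
  have hg0 : coeff 0 g = u := by
    rw [hg 0 isExponent_zero, invCoeff, if_pos rfl]
  refine ⟨g, ext_coeff fun ρ hρ => ?_, hg0⟩
  rw [coeff_one]
  split_ifs with h
  · rw [h, coeff_zero_mul, hg0, hu]
  · have key : ∀ x ∈ (Finset.HasAntidiagonal.antidiagonal ρ).erase (0, ρ),
        (reorderSign σ x.1 x.2 : R) * (coeff x.1 f * coeff x.2 g) =
        if _ : x.2 < ρ then
          (reorderSign σ x.1 x.2 : R) * (coeff x.1 f * invCoeff f u x.2) else 0 := by
      rintro ⟨i, j⟩ hx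
      obtain ⟨hne, hx⟩ := Finset.mem_erase.1 hx
      have hsum : i + j = ρ := Finset.HasAntidiagonal.mem_antidiagonal.1 hx
      have hle : j ≤ ρ := hsum ▸ le_add_self
      have hlt : j < ρ := lt_of_le_of_ne hle fun hj => hne <| by
        have : i = 0 := by simpa [hj] using hsum
        rw [this, hj]
      rw [dif_pos hlt, hg j (isExponent_of_le hρ hle)]
    have hmem : ((0, ρ) : (Fin q →₀ ℕ) × (Fin q →₀ ℕ)) ∈
        Finset.HasAntidiagonal.antidiagonal ρ := by simp
    rw [coeff_mul hρ, ← Finset.add_sum_erase _ _ hmem, Finset.sum_congr rfl key, hg ρ hρ,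
      invCoeff, if_neg h, ← Finset.add_sum_erase _ _ hmem]
    simp only [reorderSign_zero_left, Int.cast_one, one_mul, lt_irrefl, dite_false, zero_add]
    rw [← mul_assoc, mul_neg, hu, neg_one_mul, neg_add_cancel]

/-- A formal power series is invertible as soon as its body is. -/
theorem isUnit_of_isUnit_coeff_zero {f : SuperSeries σ R} (h : IsUnit (coeff 0 f)) :
    IsUnit f := by
  obtain ⟨u, hu⟩ := h.exists_right_inv
  obtain ⟨g, hfg, hg⟩ := exists_right_inv f hu
  obtain ⟨k, hgk, -⟩ := exists_right_inv g (u := coeff 0 f) (by rw [hg, mul_comm, hu])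
  -- `g` has the left inverse `f` and the right inverse `k`, which therefore agree
  have hfk : f = k := left_inv_eq_right_inv hfg hgk
  exact ⟨⟨f, g, hfg, hfk ▸ hgk⟩, rfl⟩

variable [Algebra ℝ R]

theorem isUnit_iff_body {f : SuperSeries σ R} : IsUnit f ↔ IsUnit (body f) :=
  ⟨fun h => h.map body, isUnit_of_isUnit_coeff_zero⟩

@[simp] theorem body_const (r : R) : body (const σ r) = r :=
  (coeff_of_isExponent isExponent_zero _).trans (if_pos rfl)

theorem body_map {S : Type*} [CommRing S] [Algebra ℝ S] (φ : R →ₐ[ℝ] S) (f : SuperSeries σ R) :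
    body (map φ f) = φ (body f) :=
  (coeff_of_isExponent isExponent_zero _).trans
    (congrArg φ (coeff_of_isExponent isExponent_zero f).symm)

end SuperSeries

/-! ### Smooth structures and their smooth functions -/

section Smooth

variable {p : ℕ} {M : Type u} [TopologicalSpace M] [ChartedSpace (EuclideanSpace ℝ (Fin p)) M]

theorem contMDiff_restrict_iff {U : Opens M} {G : M → ℝ} :
    ContMDiff (𝓡 p) 𝓘(ℝ, ℝ) ∞ (fun x : U => G x) ↔ ContMDiffOn (𝓡 p) 𝓘(ℝ, ℝ) ∞ G U := by
  constructor
  · intro h x hx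
    exact (contMDiffAt_subtype_iff.1 (h ⟨x, hx⟩)).contMDiffWithinAt
  · intro h x
    exact contMDiffAt_subtype_iff.2 ((h x x.2).contMDiffAt (U.isOpen.mem_nhds x.2))

theorem SmoothFun.contMDiffOn {U : Opens M} (g : SmoothFun p U) {G : M → ℝ}
    (h : ∀ x : U, G x = g x) : ContMDiffOn (𝓡 p) 𝓘(ℝ, ℝ) ∞ G U := by
  rw [← contMDiff_restrict_iff, funext h]
  exact g.contMDiff

theorem mem_contDiffGroupoid_iff
    {e : OpenPartialHomeomorph (EuclideanSpace ℝ (Fin p)) (EuclideanSpace ℝ (Fin p))} :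
    e ∈ contDiffGroupoid ∞ (𝓡 p) ↔
      ContDiffOn ℝ ∞ e e.source ∧ ContDiffOn ℝ ∞ e.symm e.target := by
  rw [contDiffGroupoid, mem_groupoid_of_pregroupoid]
  simp [contDiffPregroupoid]

end Smooth

namespace SmoothStructure

variable {p : ℕ} {M : Type u} [TopologicalSpace M]

/-- Smoothness on an open subset `U`, for a given smooth structure, of a function on `M`. -/
def SmoothOn (S : SmoothStructure p M) (U : Opens M) (G : M → ℝ) : Prop :=
  letI := S.charted
  ContMDiffOn (𝓡 p) 𝓘(ℝ, ℝ) ∞ G U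

/-- The section of the sheaf of smooth functions given by a function smooth on `U`. -/
noncomputable def mkSection (S : SmoothStructure p M) {U : Opens M} {G : M → ℝ}
    (h : S.SmoothOn U G) : S.sheaf.presheaf.obj (op U) :=
  letI := S.charted
  (⟨fun x : U => G x, contMDiff_restrict_iff.2 h⟩ : SmoothFun p U)

theorem eval_map (S : SmoothStructure p M) {U V : Opens M} (i : V ⟶ U)
    (g : S.sheaf.presheaf.obj (op U)) (m : V) :
    S.eval ((S.sheaf.presheaf.map i.op).hom g) m = S.eval g ⟨m, i.le m.2⟩ := rfl

theorem eval_ext (S : SmoothStructure p M) {U : Opens M} {g h : S.sheaf.presheaf.obj (op U)}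
    (H : ∀ m, S.eval g m = S.eval h m) : g = h :=
  letI := S.charted
  ContMDiffMap.ext (f := (g : SmoothFun p U)) (g := (h : SmoothFun p U)) H

theorem smoothOn_of_eval (S : SmoothStructure p M) {U : Opens M}
    (g : S.sheaf.presheaf.obj (op U)) {G : M → ℝ} (h : ∀ m : U, G m = S.eval g m) :
    S.SmoothOn U G :=
  letI := S.charted
  SmoothFun.contMDiffOn (U := U) g h

theorem SmoothOn.congr {S : SmoothStructure p M} {U : Opens M} {G H : M → ℝ}
    (h : S.SmoothOn U G) (hGH : ∀ m ∈ U, H m = G m) : S.SmoothOn U H :=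
  letI := S.charted
  ContMDiffOn.congr h hGH

theorem smoothOn_of_locally {S : SmoothStructure p M} {U : Opens M} {G : M → ℝ}
    (h : ∀ m ∈ U, ∃ V : Opens M, m ∈ V ∧ S.SmoothOn V G) : S.SmoothOn U G := by
  let := S.charted
  intro m hm
  obtain ⟨V, hmV, hV⟩ := h m hm
  exact ((hV m hmV).contMDiffAt (V.isOpen.mem_nhds hmV)).contMDiffWithinAt

theorem smoothOn_comp_chart {S : SmoothStructure p M}
    {e : OpenPartialHomeomorph M (EuclideanSpace ℝ (Fin p))} (he : e ∈ S.maximalAtlas)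
    {V : Opens M} {W : Set (EuclideanSpace ℝ (Fin p))} {h : EuclideanSpace ℝ (Fin p) → ℝ}
    (hh : ContDiffOn ℝ ∞ h W) (hV : (V : Set M) ⊆ e.source ∩ e ⁻¹' W) :
    S.SmoothOn V (h ∘ e) := by
  let := S.charted
  exact hh.contMDiffOn.comp ((contMDiffOn_of_mem_maximalAtlas he).mono fun x hx => (hV hx).1)
    fun x hx => (hV hx).2

theorem SmoothOn.contDiffOn {S : SmoothStructure p M}
    {e : OpenPartialHomeomorph M (EuclideanSpace ℝ (Fin p))} (he : e ∈ S.maximalAtlas)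
    {U : Opens M} {G : M → ℝ} (h : S.SmoothOn U G) :
    ContDiffOn ℝ ∞ (G ∘ e.symm) (e.target ∩ e.symm ⁻¹' U) := by
  let := S.charted
  rw [← contMDiffOn_iff_contDiffOn]
  exact ContMDiffOn.comp h ((contMDiffOn_symm_of_mem_maximalAtlas he).mono fun x hx => hx.1)
    fun x hx => hx.2

/-- If all functions smooth for `S'` are smooth for `S`, then the charts of `S'` are smooth when
read in charts of `S`, because their coordinates are smooth functions. -/
theorem contDiffOn_symm_trans {S S' : SmoothStructure p M}
    (H : ∀ U G, S'.SmoothOn U G → S.SmoothOn U G)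
    {e e' : OpenPartialHomeomorph M (EuclideanSpace ℝ (Fin p))}
    (he : e ∈ S.maximalAtlas) (he' : e' ∈ S'.maximalAtlas) :
    ContDiffOn ℝ ∞ (e.symm ≫ₕ e') (e.symm ≫ₕ e').source := by
  refine contDiffOn_euclidean.2 fun i => ?_
  let U : Opens M := ⟨e'.source, e'.open_source⟩
  have h1 : S'.SmoothOn U ((fun y : EuclideanSpace ℝ (Fin p) => y i) ∘ e') :=
    smoothOn_comp_chart (W := Set.univ) he' (by fun_prop) fun x hx => ⟨hx, trivial⟩
  have h2 := (H _ _ h1).contDiffOn he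
  rw [OpenPartialHomeomorph.trans_source, OpenPartialHomeomorph.symm_source]
  exact h2

theorem maximalAtlas_subset {S S' : SmoothStructure p M}
    (H : ∀ U G, S'.SmoothOn U G ↔ S.SmoothOn U G) : S'.maximalAtlas ⊆ S.maximalAtlas := by
  intro e' he' e he
  have he : e ∈ S.maximalAtlas := by
    let := S.charted
    have := S.isManifold
    exact IsManifold.subset_maximalAtlas he
  have h1 := contDiffOn_symm_trans (fun U G => (H U G).1) he he'
  have h2 := contDiffOn_symm_trans (fun U G => (H U G).2) he' he
  have h3 := mem_contDiffGroupoid_iff.2 ⟨h1, h2⟩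
  exact ⟨(contDiffGroupoid ∞ (𝓡 p)).symm h3, h3⟩

/-- A smooth structure is determined by its smooth functions. -/
theorem maximalAtlas_eq {S S' : SmoothStructure p M}
    (H : ∀ U G, S'.SmoothOn U G ↔ S.SmoothOn U G) : S'.maximalAtlas = S.maximalAtlas :=
  (maximalAtlas_subset H).antisymm (maximalAtlas_subset fun U G => (H U G).symm)

end SmoothStructure

/-! ### The body of a section in a chart -/

theorem SmoothFun.isUnit_of_forall_ne_zero {p : ℕ} {M : Type u} [TopologicalSpace M]
    [ChartedSpace (EuclideanSpace ℝ (Fin p)) M] {U : Opens M} {g : SmoothFun p U}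
    (h : ∀ x, g x ≠ 0) : IsUnit g := by
  have hinv : ContMDiff (𝓡 p) 𝓘(ℝ, ℝ) ∞ fun x => (g x)⁻¹ := g.contMDiff.inv₀ h
  exact IsUnit.of_mul_eq_one (⟨_, hinv⟩ : SmoothFun p U)
    (ContMDiffMap.ext fun x => mul_inv_cancel₀ (h x))

namespace Z2nRingedSpace

variable {n : ℕ} {M : Type u} [TopologicalSpace M] {A : Z2nRingedSpace n M}

theorem res_res {U V W : Opens M} (h : U ≤ V) (h' : V ≤ W) (f : A.Sec W) :
    A.res h (A.res h' f) = A.res (h.trans h') f := by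
  have : (A.sheaf.presheaf.map (homOfLE (h.trans h')).op) =
      A.sheaf.presheaf.map (homOfLE h').op ≫ A.sheaf.presheaf.map (homOfLE h).op := by
    rw [← Functor.map_comp]
    rfl
  simp only [res, this]
  rfl

namespace SuperChart

variable {p q : ℕ} {σ : Fin q → Z2n n} (φ : A.SuperChart p σ)

/-- The open subset `φ(U ∩ dom φ)` of `ℝᵖ`. -/
def image (U : Opens M) : Opens (EuclideanSpace ℝ (Fin p)) :=
  ⟨φ.base.target ∩ φ.base.symm ⁻¹' U, φ.base.isOpen_inter_preimage_symm U.isOpen⟩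

/-- The open subset `φ⁻¹(W)` of `M`. -/
abbrev preimage (W : Opens (EuclideanSpace ℝ (Fin p))) : Opens M :=
  ⟨φ.base.source ∩ φ.base ⁻¹' W, φ.base.isOpen_inter_preimage W.isOpen⟩

theorem image_subset_target (U : Opens M) : (φ.image U : Set _) ⊆ φ.base.target :=
  Set.inter_subset_left

theorem image_mono {U V : Opens M} (h : U ≤ V) : φ.image U ≤ φ.image V :=
  Set.inter_subset_inter_right _ (Set.preimage_mono h)

theorem apply_mem_image {U : Opens M} {m : M} (hm : m ∈ U) (hs : m ∈ φ.base.source) :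
    φ.base m ∈ φ.image U :=
  ⟨φ.base.map_source hs, by rwa [Set.mem_preimage, φ.base.left_inv hs]⟩

theorem preimage_image_le (U : Opens M) : φ.preimage (φ.image U) ≤ U := fun m hm => by
  have := hm.2.2
  rwa [Set.mem_preimage, φ.base.left_inv hm.1] at this

theorem image_preimage_le (W : Opens (EuclideanSpace ℝ (Fin p))) : φ.image (φ.preimage W) ≤ W :=
  fun x hx => by
    have := hx.2.2
    rwa [Set.mem_preimage, φ.base.right_inv hx.1] at this

/-- The power series expansion of the restriction of a section to the domain of a chart. -/
noncomputable def series (U : Opens M) : A.Sec U →ₐ[ℝ] DomainFun σ (φ.image U) :=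
  (φ.pullback (φ.image U) (φ.image_subset_target U)).symm.toAlgHom.comp
    (A.res (φ.preimage_image_le U))

theorem pullback_series {U : Opens M} (f : A.Sec U) :
    φ.pullback _ (φ.image_subset_target U) (φ.series U f) = A.res (φ.preimage_image_le U) f :=
  AlgEquiv.apply_symm_apply _ _

theorem series_eq_iff {U : Opens M} (f : A.Sec U) (F : DomainFun σ (φ.image U)) :
    φ.series U f = F ↔
      A.res (φ.preimage_image_le U) f = φ.pullback _ (φ.image_subset_target U) F :=
  AlgEquiv.symm_apply_eq _

theorem series_res {U V : Opens M} (h : V ≤ U) (f : A.Sec U) :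
    φ.series V (A.res h f) = SuperSeries.map (SmoothFun.res p (φ.image_mono h)) (φ.series U f) := by
  rw [series_eq_iff, φ.pullback_res _ (φ.image_subset_target U), pullback_series, res_res]
  exact (res_res _ _ f).symm

theorem series_pullback {W : Opens (EuclideanSpace ℝ (Fin p))} (hW : (W : Set _) ⊆ φ.base.target)
    (F : DomainFun σ W) :
    φ.series _ (φ.pullback W hW F) =
      SuperSeries.map (SmoothFun.res p (φ.image_preimage_le W)) F := by
  rw [series_eq_iff, φ.pullback_res _ hW]

/-- The body of a section in a chart: the term of degree zero in the formal variables. -/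
noncomputable def body (U : Opens M) : A.Sec U →ₐ[ℝ] SmoothFun p (φ.image U) :=
  SuperSeries.body.comp (φ.series U)

theorem body_res {U V : Opens M} (h : V ≤ U) (f : A.Sec U) :
    φ.body V (A.res h f) = SmoothFun.res p (φ.image_mono h) (φ.body U f) := by
  simp only [body, AlgHom.comp_apply, series_res, SuperSeries.body_map]

theorem body_pullback {W : Opens (EuclideanSpace ℝ (Fin p))} (hW : (W : Set _) ⊆ φ.base.target)
    (F : DomainFun σ W) :
    φ.body _ (φ.pullback W hW F) =
      SmoothFun.res p (φ.image_preimage_le W) (SuperSeries.body F) := by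
  simp only [body, AlgHom.comp_apply, series_pullback, SuperSeries.body_map]

theorem body_ne_zero_of_isUnit {U : Opens M} {f : A.Sec U} (hf : IsUnit f) (x : φ.image U) :
    φ.body U f x ≠ 0 := by
  obtain ⟨g, hg⟩ := (hf.map (φ.body U)).exists_right_inv
  intro h0
  have := congrArg (fun s : SmoothFun p (φ.image U) => s x) hg
  simp [h0] at this

/-- A section whose body does not vanish at a point is invertible near that point. -/
theorem exists_isUnit_res {U : Opens M} {f : A.Sec U} {m : M} (hm : m ∈ U)
    (hs : m ∈ φ.base.source) (hf : φ.body U f ⟨φ.base m, φ.apply_mem_image hm hs⟩ ≠ 0) :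
    ∃ (V : Opens M) (hV : V ≤ U), m ∈ V ∧ IsUnit (A.res hV f) := by
  let W : Opens (EuclideanSpace ℝ (Fin p)) :=
    ⟨Subtype.val '' {x : φ.image U | φ.body U f x ≠ 0},
      (φ.image U).isOpen.isOpenMap_subtype_val _
        (isOpen_ne_fun (φ.body U f).contMDiff.continuous continuous_const)⟩
  have hW : W ≤ φ.image U := by
    rintro _ ⟨x, -, rfl⟩
    exact x.2
  have hV : φ.preimage W ≤ φ.preimage (φ.image U) :=
    Set.inter_subset_inter_right _ (Set.preimage_mono hW)
  refine ⟨φ.preimage W, hV.trans (φ.preimage_image_le U), ⟨hs, ⟨_, hf, rfl⟩⟩, ?_⟩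
  rw [← res_res hV (φ.preimage_image_le U), ← pullback_series,
    ← φ.pullback_res hW (φ.image_subset_target U)]
  refine IsUnit.map _ (SuperSeries.isUnit_iff_body.2 ?_)
  rw [SuperSeries.body_map]
  refine SmoothFun.isUnit_of_forall_ne_zero ?_
  rintro ⟨_, x, hx, rfl⟩
  exact hx

/-- The number `k` for which `f - k` is not invertible near `m` is the value at `m` of the body
of `f`, in every chart around `m`. -/
theorem notInvertibleNear_iff {U : Opens M} {f : A.Sec U} {m : U} (hs : (m : M) ∈ φ.base.source)
    {k : ℝ} :
    A.NotInvertibleNear f m k ↔ φ.body U f ⟨φ.base m, φ.apply_mem_image m.2 hs⟩ = k := by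
  have hk : φ.body U (f - algebraMap ℝ _ k) ⟨φ.base m, φ.apply_mem_image m.2 hs⟩ =
      φ.body U f ⟨φ.base m, φ.apply_mem_image m.2 hs⟩ - k := by
    rw [map_sub, AlgHom.commutes]
    rfl
  constructor
  · intro h
    by_contra hne
    obtain ⟨V, hV, hmV, hu⟩ := φ.exists_isUnit_res m.2 hs (hk.trans_ne (sub_ne_zero.2 hne))
    exact h V hV hmV hu
  · intro h V hV hmV hu
    refine φ.body_ne_zero_of_isUnit hu ⟨φ.base m, φ.apply_mem_image hmV hs⟩ ?_
    rw [body_res]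
    exact hk.trans (sub_eq_zero.2 h)

end SuperChart
end Z2nRingedSpace

/-! ### The smooth structure of a supermanifold -/

/-- Evaluation of smooth functions at a point. -/
noncomputable def SmoothFun.evalAlgHom {p : ℕ} {M : Type u} [TopologicalSpace M]
    [ChartedSpace (EuclideanSpace ℝ (Fin p)) M] {U : Opens M} (x : U) :
    SmoothFun p U →ₐ[ℝ] ℝ where
  toFun g := g x
  map_one' := rfl
  map_mul' _ _ := rfl
  map_zero' := rfl
  map_add' _ _ := rfl
  commutes' _ := rfl

namespace Z2nRingedSpace

variable {n : ℕ} {M : Type u} [TopologicalSpace M] {A : Z2nRingedSpace n M} {p : ℕ}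

namespace SuperChart

variable {q : ℕ} {σ : Fin q → Z2n n} (φ : A.SuperChart p σ)

/-- The body of a section in a chart, extended by zero to all of `ℝᵖ`. -/
noncomputable def bodyFun {U : Opens M} (f : A.Sec U) : EuclideanSpace ℝ (Fin p) → ℝ :=
  fun x => open Classical in if h : x ∈ φ.image U then φ.body U f ⟨x, h⟩ else 0

theorem bodyFun_of_mem {U : Opens M} (f : A.Sec U) {x : EuclideanSpace ℝ (Fin p)}
    (h : x ∈ φ.image U) : φ.bodyFun f x = φ.body U f ⟨x, h⟩ := dif_pos h

theorem contDiffOn_bodyFun {U : Opens M} (f : A.Sec U) :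
    ContDiffOn ℝ ∞ (φ.bodyFun f) (φ.image U) := by
  rw [← contMDiffOn_iff_contDiffOn]
  exact SmoothFun.contMDiffOn (φ.body U f) fun x => φ.bodyFun_of_mem f x.2

/-- The coordinates of a chart `ψ` are the bodies of sections. As the body of a section is
smooth in every chart, changes of charts are smooth. -/
theorem contDiffOn_transition {q' : ℕ} {τ : Fin q' → Z2n n} (ψ : A.SuperChart p τ) :
    ContDiffOn ℝ ∞ (φ.base.symm ≫ₕ ψ.base) (φ.base.symm ≫ₕ ψ.base).source := by
  refine contDiffOn_euclidean.2 fun i => ?_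
  let W : Opens (EuclideanSpace ℝ (Fin p)) := ⟨ψ.base.target, ψ.base.open_target⟩
  have hy : ContMDiffOn (𝓡 p) 𝓘(ℝ, ℝ) ∞ (fun y : EuclideanSpace ℝ (Fin p) => y i) W := by
    rw [contMDiffOn_iff_contDiffOn]
    fun_prop
  let y : SmoothFun p W := ⟨fun y => y.1 i, contMDiff_restrict_iff.2 hy⟩
  let s := ψ.pullback W subset_rfl (SuperSeries.const τ y)
  refine ((φ.contDiffOn_bodyFun s).mono fun x hx => ?_).congr ?_
  · exact ⟨hx.1, hx.2, ψ.base.map_source hx.2⟩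
  · rintro x ⟨hx, hxψ⟩
    have hx' : φ.base.symm x ∈ ψ.base.source := hxψ
    have hsrc : φ.base.symm x ∈ φ.base.source := φ.base.map_target hx
    have hmem : φ.base.symm x ∈ ψ.preimage W := ⟨hx', ψ.base.map_source hx'⟩
    have key : A.NotInvertibleNear s ⟨_, hmem⟩ (ψ.base (φ.base.symm x) i) := by
      refine (ψ.notInvertibleNear_iff hx').2 ?_
      rw [body_pullback, SuperSeries.body_const]
      rfl
    rw [φ.notInvertibleNear_iff hsrc, ← bodyFun_of_mem] at key
    change ψ.base (φ.base.symm x) i = _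
    rw [← key]
    exact congrArg _ (φ.base.right_inv hx)

end SuperChart

namespace IsSupermanifold

variable {d : {γ : Z2n n // γ ≠ 0} → ℕ} (hA : A.IsSupermanifold p d)
include hA

/-- The smooth structure whose charts are the base homeomorphisms of all charts of the
supermanifold, whatever the order of their formal variables. -/
noncomputable def smoothStructure : SmoothStructure p M :=
  let charted : ChartedSpace (EuclideanSpace ℝ (Fin p)) M :=
    { atlas := {e | ∃ (q : ℕ) (σ : Fin q → Z2n n) (φ : A.SuperChart p σ), φ.base = e}
      chartAt := fun m => (hA.exists_chart m).choose_spec.choose_spec.2.2.choose.base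
      mem_chart_source := fun m => (hA.exists_chart m).choose_spec.choose_spec.2.2.choose_spec
      chart_mem_atlas := fun m => ⟨_, _, _, rfl⟩ }
  { charted := charted
    isManifold := isManifold_of_contDiffOn (𝓡 p) ∞ M <| by
      rintro _ _ ⟨q, σ, φ, rfl⟩ ⟨q', τ, ψ, rfl⟩
      simpa using φ.contDiffOn_transition ψ }

theorem base_mem_maximalAtlas {q : ℕ} {σ : Fin q → Z2n n} (φ : A.SuperChart p σ) :
    φ.base ∈ hA.smoothStructure.maximalAtlas := by
  let := hA.smoothStructure.charted
  have := hA.smoothStructure.isManifold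
  exact IsManifold.subset_maximalAtlas ⟨q, σ, φ, rfl⟩

theorem exists_superChart (m : M) :
    ∃ (q : ℕ) (σ : Fin q → Z2n n) (φ : A.SuperChart p σ), m ∈ φ.base.source := by
  obtain ⟨q, σ, -, -, φ, h⟩ := hA.exists_chart m
  exact ⟨q, σ, φ, h⟩

theorem exists_value {U : Opens M} (m : U) :
    ∃ v : A.Sec U →ₐ[ℝ] ℝ, ∀ f, A.NotInvertibleNear f m (v f) := by
  obtain ⟨q, σ, φ, hs⟩ := hA.exists_superChart m
  exact ⟨(SmoothFun.evalAlgHom ⟨φ.base m, φ.apply_mem_image m.2 hs⟩).comp (φ.body U),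
    fun f => (φ.notInvertibleNear_iff hs).2 rfl⟩

theorem notInvertibleNear_unique {U : Opens M} {f : A.Sec U} {m : U} {k l : ℝ}
    (hk : A.NotInvertibleNear f m k) (hl : A.NotInvertibleNear f m l) : k = l := by
  obtain ⟨q, σ, φ, hs⟩ := hA.exists_superChart m
  rw [φ.notInvertibleNear_iff hs] at hk hl
  rw [← hk, hl]

/-- The value `ε_U(f)(m)` of a section `f` at a point `m`, as an algebra morphism in `f`. It is
characterized by `notInvertibleNear_value`, without reference to a chart. -/
noncomputable def value {U : Opens M} (m : U) : A.Sec U →ₐ[ℝ] ℝ := (hA.exists_value m).choose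

theorem notInvertibleNear_value {U : Opens M} (f : A.Sec U) (m : U) :
    A.NotInvertibleNear f m (hA.value m f) := (hA.exists_value m).choose_spec f

theorem value_eq_body {q : ℕ} {σ : Fin q → Z2n n} (φ : A.SuperChart p σ) {U : Opens M}
    (f : A.Sec U) {m : U} (hs : (m : M) ∈ φ.base.source) :
    hA.value m f = φ.body U f ⟨φ.base m, φ.apply_mem_image m.2 hs⟩ :=
  ((φ.notInvertibleNear_iff hs).1 (hA.notInvertibleNear_value f m)).symm

theorem value_res {U V : Opens M} (h : V ≤ U) (f : A.Sec U) (m : V) :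
    hA.value m (A.res h f) = hA.value ⟨m, h m.2⟩ f :=
  hA.notInvertibleNear_unique (hA.notInvertibleNear_value _ _) fun W hW hm => by
    have := hA.notInvertibleNear_value f ⟨m, h m.2⟩ W (hW.trans h) hm
    rwa [← res_res hW h, map_sub (A.res h), AlgHom.commutes] at this

/-- The function `ε_U(f)`, extended by zero to all of `M`. -/
noncomputable def valueFun {U : Opens M} (f : A.Sec U) : M → ℝ :=
  fun m => open Classical in if h : m ∈ U then hA.value ⟨m, h⟩ f else 0

theorem valueFun_of_mem {U : Opens M} (f : A.Sec U) {m : M} (h : m ∈ U) :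
    hA.valueFun f m = hA.value ⟨m, h⟩ f := dif_pos h

theorem smoothOn_valueFun {U : Opens M} (f : A.Sec U) :
    hA.smoothStructure.SmoothOn U (hA.valueFun f) := by
  refine SmoothStructure.smoothOn_of_locally fun m hm => ?_
  obtain ⟨q, σ, φ, hs⟩ := hA.exists_superChart m
  refine ⟨φ.preimage (φ.image U), ⟨hs, φ.apply_mem_image hm hs⟩, ?_⟩
  refine (SmoothStructure.smoothOn_comp_chart (hA.base_mem_maximalAtlas φ)
    (φ.contDiffOn_bodyFun f) subset_rfl).congr fun x hx => ?_
  rw [hA.valueFun_of_mem f (φ.preimage_image_le U hx), hA.value_eq_body φ f hx.1,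
    Function.comp_apply, φ.bodyFun_of_mem f hx.2]

/-- Every smooth function is locally the value of a section, namely of a section given in a chart
by a power series without terms of positive degree. -/
theorem exists_valueFun_eq {U : Opens M} {G : M → ℝ} (hG : hA.smoothStructure.SmoothOn U G)
    {m : M} (hm : m ∈ U) :
    ∃ (V : Opens M) (_ : V ≤ U) (f : A.Sec V), m ∈ V ∧ ∀ x : V, hA.value x f = G x := by
  obtain ⟨q, σ, φ, hs⟩ := hA.exists_superChart m
  have hg : ContMDiffOn (𝓡 p) 𝓘(ℝ, ℝ) ∞ (G ∘ φ.base.symm) (φ.image U) := by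
    rw [contMDiffOn_iff_contDiffOn]
    exact hG.contDiffOn (hA.base_mem_maximalAtlas φ)
  let g : SmoothFun p (φ.image U) := ⟨fun y => G (φ.base.symm y), contMDiff_restrict_iff.2 hg⟩
  refine ⟨φ.preimage (φ.image U), φ.preimage_image_le U,
    φ.pullback _ (φ.image_subset_target U) (SuperSeries.const σ g),
    ⟨hs, φ.apply_mem_image hm hs⟩, fun x => ?_⟩
  rw [hA.value_eq_body φ _ x.2.1, φ.body_pullback, SuperSeries.body_const]
  exact congrArg G (φ.base.left_inv x.2.1)

/-- The morphism `ε : A → C^∞` of sheaves of algebras. -/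
noncomputable def toSmooth : A.sheaf ⟶ hA.smoothStructure.sheaf :=
  ⟨{ app := fun U => AlgCat.ofHom (R := ℝ) (A := A.Sec (unop U))
      (B := hA.smoothStructure.sheaf.presheaf.obj U)
      { toFun := fun f => hA.smoothStructure.mkSection (hA.smoothOn_valueFun f)
        map_one' := hA.smoothStructure.eval_ext fun m => by
          change hA.valueFun _ m = 1
          rw [hA.valueFun_of_mem _ m.2, map_one]
        map_mul' := fun f g => hA.smoothStructure.eval_ext fun m => by
          change hA.valueFun _ m = hA.valueFun _ m * hA.valueFun _ m
          simp only [hA.valueFun_of_mem _ m.2, map_mul]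
        map_zero' := hA.smoothStructure.eval_ext fun m => by
          change hA.valueFun _ m = 0
          rw [hA.valueFun_of_mem _ m.2, map_zero]
        map_add' := fun f g => hA.smoothStructure.eval_ext fun m => by
          change hA.valueFun _ m = hA.valueFun _ m + hA.valueFun _ m
          simp only [hA.valueFun_of_mem _ m.2, map_add]
        commutes' := fun c => hA.smoothStructure.eval_ext fun m => by
          change hA.valueFun _ m = c
          rw [hA.valueFun_of_mem _ m.2, AlgHom.commutes]
          rfl }
     naturality := fun U V i => by
      ext f
      refine hA.smoothStructure.eval_ext fun m => ?_
      change hA.valueFun (A.res i.unop.le f) m = hA.valueFun f m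
      rw [hA.valueFun_of_mem _ m.2, hA.valueFun_of_mem f (i.unop.le m.2), hA.value_res] }⟩

theorem eval_toSmooth {U : Opens M} (f : A.Sec U) (m : U) :
    hA.smoothStructure.eval ((hA.toSmooth.hom.app (op U)).hom f) m = hA.value m f :=
  hA.valueFun_of_mem f m.2

end IsSupermanifold
end Z2nRingedSpace

/-! ### Exactness and uniqueness -/

theorem epi_toAbSheaf_map_iff {M : Type u} [TopologicalSpace M]
    {A B : TopCat.Sheaf (AlgCat.{u} ℝ) (TopCat.of M)} (ε : A ⟶ B) :
    Epi ((toAbSheaf M).map ε) ↔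
      ∀ (U : Opens M) (t : B.presheaf.obj (op U)), ∀ x ∈ U, ∃ (V : Opens M) (h : V ≤ U),
        x ∈ V ∧ ∃ s : A.presheaf.obj (op V),
          (ε.hom.app (op V)).hom s = (B.presheaf.map (homOfLE h).op).hom t := by
  rw [← TopCat.Sheaf.isLocallySurjective_iff_epi, TopCat.Presheaf.isLocallySurjective_iff]
  constructor
  · intro H U t x hx
    obtain ⟨V, h, ⟨s, hs⟩, hxV⟩ := H U t x hx
    exact ⟨V, h, hxV, s, hs⟩
  · intro H U t x hx
    obtain ⟨V, h, hxV, s, hs⟩ := H U t x hx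
    exact ⟨V, h, ⟨s, hs⟩, hxV⟩

theorem kernelSequence_shortExact_iff {M : Type u} [TopologicalSpace M]
    {A B : TopCat.Sheaf (AlgCat.{u} ℝ) (TopCat.of M)} (ε : A ⟶ B) :
    (kernelSequence ε).ShortExact ↔ Epi ((toAbSheaf M).map ε) :=
  ⟨fun h => h.epi_g, fun h =>
    { exact := ShortComplex.exact_kernel _
      mono_f := Limits.equalizer.ι_mono
      epi_g := h }⟩

namespace Z2nRingedSpace.IsSupermanifold

variable {n p : ℕ} {M : Type u} [TopologicalSpace M] {A : Z2nRingedSpace n M}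
  {d : {γ : Z2n n // γ ≠ 0} → ℕ} (hA : A.IsSupermanifold p d)
include hA

theorem shortExact_toSmooth : (kernelSequence hA.toSmooth).ShortExact := by
  rw [kernelSequence_shortExact_iff, epi_toAbSheaf_map_iff]
  intro U t x hx
  let G : M → ℝ := fun y => open Classical in
    if h : y ∈ U then hA.smoothStructure.eval t ⟨y, h⟩ else 0
  have hG : ∀ y : U, G y = hA.smoothStructure.eval t y := fun y => dif_pos y.2
  obtain ⟨V, hV, f, hxV, hf⟩ :=
    hA.exists_valueFun_eq (hA.smoothStructure.smoothOn_of_eval t hG) hx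
  refine ⟨V, hV, hxV, f, hA.smoothStructure.eval_ext fun y => ?_⟩
  rw [hA.eval_toSmooth, hf, SmoothStructure.eval_map, ← hG]

/-- A smooth structure with a short exact sequence `0 → ker ε → A → C^∞ → 0` has the same smooth
functions as the canonical one: for both they are the functions that are locally values of
sections of the structure sheaf. -/
theorem smoothOn_iff {S : SmoothStructure p M} {ε : A.sheaf ⟶ S.sheaf}
    (hε : ∀ (U : Opens M) (f : A.Sec U) (m : U),
      A.NotInvertibleNear f m (S.eval ((ε.hom.app (op U)).hom f) m))
    (hS : (kernelSequence ε).ShortExact) (U : Opens M) (G : M → ℝ) :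
    S.SmoothOn U G ↔ hA.smoothStructure.SmoothOn U G := by
  have hval : ∀ (U : Opens M) (f : A.Sec U) (m : U),
      S.eval ((ε.hom.app (op U)).hom f) m = hA.value m f := fun U f m =>
    hA.notInvertibleNear_unique (hε U f m) (hA.notInvertibleNear_value f m)
  rw [kernelSequence_shortExact_iff, epi_toAbSheaf_map_iff] at hS
  constructor
  · intro hG
    refine SmoothStructure.smoothOn_of_locally fun m hm => ?_
    obtain ⟨V, hV, hmV, f, hf⟩ := hS U (S.mkSection hG) m hm
    refine ⟨V, hmV, (hA.smoothOn_valueFun f).congr fun x hx => ?_⟩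
    rw [hA.valueFun_of_mem f hx, ← hval, hf]
    rfl
  · intro hG
    refine SmoothStructure.smoothOn_of_locally fun m hm => ?_
    obtain ⟨V, hV, f, hmV, hf⟩ := hA.exists_valueFun_eq hG hm
    exact ⟨V, hmV, S.smoothOn_of_eval _ fun x => by rw [hval V f, hf]⟩

end Z2nRingedSpace.IsSupermanifold

theorem proposition6p1 {n p : ℕ} {d : {γ : Z2n n // γ ≠ 0} → ℕ} {M : Type u}
    [TopologicalSpace M] (A : Z2nRingedSpace n M) (hA : A.IsSupermanifold p d) :
    (∀ (U : Opens M) (f : A.Sec U) (m : U), ∃! k : ℝ, A.NotInvertibleNear f m k) ∧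
    ∃ S : SmoothStructure p M,
      (∃ ε : A.sheaf ⟶ S.sheaf,
        (∀ (U : Opens M) (f : A.Sec U) (m : U),
          A.NotInvertibleNear f m (S.eval ((ε.hom.app (op U)).hom f) m)) ∧
        (kernelSequence ε).ShortExact) ∧
      ∀ S' : SmoothStructure p M,
        (∃ ε' : A.sheaf ⟶ S'.sheaf,
          (∀ (U : Opens M) (f : A.Sec U) (m : U),
            A.NotInvertibleNear f m (S'.eval ((ε'.hom.app (op U)).hom f) m)) ∧
          (kernelSequence ε').ShortExact) →
        S'.maximalAtlas = S.maximalAtlas := by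
  refine ⟨fun U f m => ⟨hA.value m f, hA.notInvertibleNear_value f m, fun k hk =>
    hA.notInvertibleNear_unique hk (hA.notInvertibleNear_value f m)⟩, hA.smoothStructure,
    ⟨hA.toSmooth, fun U f m => ?_, hA.shortExact_toSmooth⟩, ?_⟩
  · rw [hA.eval_toSmooth]
    exact hA.notInvertibleNear_value f m
  · rintro S' ⟨ε', hε', hS'⟩
    exact SmoothStructure.maximalAtlas_eq (hA.smoothOn_iff hε' hS')
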